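/- All graphs are finite, simple and undirected. A tree decomposition of a graph $G$ is a tree $T$ together with, for each vertex $v$ of $G$, a non-empty set $B_v\subseteq V(T)$ inducing a connected subgraph of $T$, such that $B_u\cap B_v\neq\emptyset$ for every edge $uv$ of $G$; its width is $\max_{x\in V(T)}|\{v\in V(G): x\in B_v\}|-1$, and the tree-width $\operatorname{tw}(G)$ is the smallest width of a tree decomposition of $G$. For $k\ge 1$, a $k$-strong forest of $G$ is an acyclic induced subgraph of $G$ each of whose connected components has at least $k$ edges; an edge of $G$ is $k$-valid if it is contained in some $k$-strong forest of $G$; and $f_k(G)$ is the smallest number of $k$-strong forests of $G$ that together cover all $k$-valid edges of $G$. **Theorem.** For every integer $t\ge 2$ and every graph $G$ of tree-width $t$, $$f_1(G)\le\binom{t+1}{2}\qquad\text{and}\qquad f_2(G)\le 3\binom{t+1}{3}.$$ Moreover, the bound on $f_2$ is best possible for $t=2$: there is a graph $G$ with $\operatorname{tw}(G)=2$ and $f_2(G)=3=3\binom{3}{3}$. -/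

import Mathlib

universe u

/-- A tree decomposition of `G` over the tree `T`: every vertex `v` of `G` is assigned a non-empty
set `B v` of nodes of `T` that induces a connected subgraph of `T` (Mathlib's `Connected` includes
non-emptiness), and the sets of adjacent vertices meet. -/
structure TreeDecomposition {V : Type u} {ι : Type} (G : SimpleGraph V) (T : SimpleGraph ι) where
  isTree : T.IsTree
  B : V → Set ι
  connected : ∀ v, (T.induce (B v)).Connected
  meet : ∀ u v, G.Adj u v → (B u ∩ B v).Nonempty

/-- The width of a tree decomposition: the maximum number of vertices of `G` assigned to a node
of the tree, minus one. -/
noncomputable def TreeDecomposition.width {V : Type u} {ι : Type} [Fintype ι] {G : SimpleGraph V}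
    {T : SimpleGraph ι} (D : TreeDecomposition G T) : ℤ :=
  ((Finset.univ.sup fun x : ι => {v : V | x ∈ D.B v}.ncard : ℕ) : ℤ) - 1

/-- The tree-width of a finite graph: the smallest width of a tree decomposition over a finite
tree. (It is integer-valued, being `-1` for the graph without vertices.) -/
noncomputable def treeWidth {V : Type u} (G : SimpleGraph V) : ℤ :=
  sInf {w : ℤ | ∃ (ι : Type) (_ : Fintype ι) (T : SimpleGraph ι) (D : TreeDecomposition G T),
    D.width = w}

/-- The subgraph of `G` induced by the vertex set `S` is a `k`-strong forest of `G`: it is acyclic,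
and each of its connected components has at least `k` edges. Induced subgraphs are represented by
their vertex sets. -/
def IsStrongForest {V : Type u} (G : SimpleGraph V) (k : ℕ) (S : Set V) : Prop :=
  (G.induce S).IsAcyclic ∧
    ∀ c : (G.induce S).ConnectedComponent, k ≤ c.toSimpleGraph.edgeSet.ncard

/-- The edge `e` of `G` belongs to the subgraph of `G` induced by `S`. -/
def InducedContains {V : Type u} (G : SimpleGraph V) (S : Set V) (e : Sym2 V) : Prop :=
  e ∈ G.edgeSet ∧ ∀ v ∈ e, v ∈ S

/-- An edge `e` of `G` is `k`-valid if some `k`-strong forest of `G` contains it. -/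
def IsValidEdge {V : Type u} (G : SimpleGraph V) (k : ℕ) (e : Sym2 V) : Prop :=
  ∃ S : Set V, IsStrongForest G k S ∧ InducedContains G S e

/-- All `k`-valid edges of `G` can be covered with `n` `k`-strong forests of `G`. -/
def HasStrongCover {V : Type u} (G : SimpleGraph V) (k n : ℕ) : Prop :=
  ∃ F : Fin n → Set V, (∀ i, IsStrongForest G k (F i)) ∧
    ∀ e, IsValidEdge G k e → ∃ i, InducedContains G (F i) e

/-- The `k`-strong induced arboricity `f_k(G)`: the smallest number of `k`-strong forests of `G`
that cover all `k`-valid edges of `G`. -/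
noncomputable def strongInducedArboricity {V : Type u} (k : ℕ) (G : SimpleGraph V) : ℕ :=
  sInf {n : ℕ | HasStrongCover G k n}

/-- For a finite graph the minimum in `strongInducedArboricity` is over a non-empty set, so that
it is attained. -/
theorem hasStrongCover_strongInducedArboricity {V : Type u} [Finite V] (G : SimpleGraph V)
    (k : ℕ) : HasStrongCover G k (strongInducedArboricity k G) := by
  apply Nat.sInf_mem (s := {n : ℕ | HasStrongCover G k n})
  obtain ⟨n, ⟨f⟩⟩ := Finite.exists_equiv_fin {S : Set V // IsStrongForest G k S}
  refine ⟨n, fun i => (f.symm i).1, fun i => (f.symm i).2, ?_⟩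
  rintro e ⟨S, hS, he⟩
  exact ⟨f ⟨S, hS⟩, by simpa using he⟩

open SimpleGraph

/-! Root the tree of a decomposition with bags of size at most `t + 1` and order the vertices of the
graph by depth. Greedy colouring then gives `t + 1` colours, injective on every bag
(`TreeDecomposition.exists_coloring`). A vertex set meeting each bag at most twice induces a forest,
so the pairs of colours yield the forests for `f_1`.

For `f_2`, a 2-valid edge `uv` has a third vertex `w` adjacent to exactly one end
(`IsValidEdge.distinguished`). Three colours suffice to contain `u`, `v` and `w`, and three colour
classes induce a graph with bags of size at most three. In each such graph three forests cover all
distinguished edges: `HasBagsOfSize.exists_good_coloring` recolours it, not necessarily properly, so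
that omitting any colour leaves a forest and each distinguished edge extends by an adjacent third
vertex without using all three colours.

The recolouring goes by contracting an edge `ab` in no triangle. Forests lift back, and giving `a`
and `b` the same colour makes every edge at them good. A contraction is blocked only if it turns
some distinguished edge into a pair of twins. If all are blocked, the ends of each edge in no
triangle have degree two and lie on a common four-cycle, and a proper colouring already works.

For sharpness, pendant edges make all three edges of the triangle in the bull 2-valid, and no forest
contains two of them. -/

/-! ### Rooted tree decompositions and colourings injective on bags. -/

/-- A connected set of nodes of a tree that contains a node `s` at most as far from the root `r` as
every node of a second connected set `B` meeting it contains the node of `B` closest to `r`. -/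
theorem SimpleGraph.IsTree.mem_of_dist_le {ι : Type*} {T : SimpleGraph ι} (hT : T.IsTree) {r : ι}
    {A B : Set ι} (hA : (T.induce A).Connected) (hB : (T.induce B).Connected) {s t y : ι}
    (hyA : y ∈ A) (hyB : y ∈ B) (hs : s ∈ A) (ht : t ∈ B)
    (hmin : ∀ z ∈ B, T.dist t r ≤ T.dist z r) (hst : T.dist s r ≤ T.dist t r) : t ∈ A := by
  classical
  by_contra htA
  obtain ⟨p, hp⟩ := hT.connected.exists_walk_length_eq_dist t r
  cases p with
  | nil =>
    have h0 : T.dist s r = 0 := by simpa using hst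
    exact htA (((hT.connected.preconnected s r).dist_eq_zero_iff.mp h0) ▸ hs)
  | @cons _ t' _ hadj q =>
    rw [Walk.length_cons] at hp
    have ht'B : t' ∉ B := fun h => by
      have h1 := hmin t' h
      have h2 := dist_le q
      omega
    -- `B` avoids `t'` and `A` avoids `t`, so both stay connected without the edge `tt'`. Going from
    -- `t` through `B` to `y`, through `A` to `s`, and on via `r` to `t'` then contradicts that
    -- `tt'` is a bridge.
    set T' := T.deleteEdges {s(t, t')} with hT'
    have hreach : ∀ C : Set ι, (T.induce C).Connected → (t ∉ C ∨ t' ∉ C) →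
        ∀ a ∈ C, ∀ b ∈ C, T'.Reachable a b := by
      intro C hC htt a ha b hb
      let f : T.induce C →g T' := ⟨Subtype.val, by
        rintro ⟨x, hx⟩ ⟨z, hz⟩ hxz
        rw [hT', deleteEdges_adj]
        refine ⟨hxz, fun h => ?_⟩
        rcases Sym2.eq_iff.mp (Set.mem_singleton_iff.mp h) with ⟨h1, h2⟩ | ⟨h1, h2⟩ <;>
          rcases htt with h | h <;> grind⟩
      exact (hC.preconnected ⟨a, ha⟩ ⟨b, hb⟩).map f
    have hwalk : ∀ a b : ι, ∀ w : T.Walk a b, t ∉ w.support → T'.Reachable a b := by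
      intro a b w hw
      rw [hT', reachable_deleteEdges_iff_exists_walk]
      exact ⟨w, fun h => hw (w.fst_mem_support_of_mem_edges h)⟩
    have h1 : T'.Reachable t' r := by
      refine hwalk _ _ q fun h => ?_
      have h2 := dist_le (q.dropUntil t h)
      have h3 := q.length_dropUntil_le_length h
      omega
    have h2 : T'.Reachable s r := by
      obtain ⟨w, hw⟩ := hT.connected.exists_walk_length_eq_dist s r
      -- A shortest path from `s` to `r` through `t` forces `s = t`, as `s` is no farther from `r`.
      refine hwalk _ _ w fun h => htA ?_
      have h3 := dist_le (w.dropUntil t h)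
      have h4 := congrArg Walk.length (w.take_spec h)
      rw [Walk.length_append] at h4
      have h5 : (w.takeUntil t h).length = 0 := by omega
      exact Walk.eq_of_length_eq_zero h5 ▸ hs
    have h3 := isAcyclic_iff_forall_adj_isBridge.mp hT.isAcyclic hadj
    rw [isBridge_iff] at h3
    exact h3 (((hreach B hB (.inr ht'B) t ht y hyB).trans
      (hreach A hA (.inl htA) y hyA s hs)).trans (h2.trans h1.symm))

namespace TreeDecomposition

variable {V : Type u} {ι : Type} {G : SimpleGraph V} {T : SimpleGraph ι}

/-- Every vertex `v` has a depth `d v` and a top node `t v`, such that the bag of `t v` contains all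
vertices of at most the same depth that share a node with `v`. -/
theorem exists_depth (D : TreeDecomposition G T) : ∃ (d : V → ℕ) (t : V → ι),
    (∀ v, t v ∈ D.B v) ∧
      ∀ u v, (D.B u ∩ D.B v).Nonempty → d u ≤ d v → t v ∈ D.B u := by
  obtain ⟨r⟩ := D.isTree.connected.nonempty
  have hne : ∀ v, (D.B v).Nonempty := fun v => Set.nonempty_coe_sort.mp (D.connected v).nonempty
  choose t ht hmin using fun v => exists_minimalFor_of_wellFoundedLT (· ∈ D.B v)
    (fun x => T.dist x r) (hne v)
  refine ⟨fun v => T.dist (t v) r, t, ht, fun u v ⟨y, hyu, hyv⟩ huv => ?_⟩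
  refine D.isTree.mem_of_dist_le (D.connected u) (D.connected v) hyu hyv (ht u) (ht v) ?_ huv
  intro z hz
  by_contra h
  exact h (hmin v hz (le_of_not_ge h))

/-- A clique of `G` is contained in some bag. -/
theorem exists_bag_of_clique (D : TreeDecomposition G T) {s : Finset V} (hs : s.Nonempty)
    (hc : ∀ u ∈ s, ∀ v ∈ s, u ≠ v → G.Adj u v) : ∃ x, ∀ v ∈ s, x ∈ D.B v := by
  obtain ⟨d, t, ht, htop⟩ := D.exists_depth
  obtain ⟨v, hv, hmax⟩ := s.exists_max_image d hs
  refine ⟨t v, fun u hu => ?_⟩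
  by_cases huv : u = v
  · exact huv ▸ ht v
  · exact htop u v (D.meet u v (hc u hu v hv huv)) (hmax u hu)

theorem card_le_of_clique [Finite V] (D : TreeDecomposition G T) {k : ℕ}
    (hD : ∀ x, {v | x ∈ D.B v}.ncard ≤ k) {s : Finset V}
    (hc : ∀ u ∈ s, ∀ v ∈ s, u ≠ v → G.Adj u v) : s.card ≤ k := by
  rcases s.eq_empty_or_nonempty with rfl | hs
  · simp
  · obtain ⟨x, hx⟩ := D.exists_bag_of_clique hs hc
    rw [← Set.ncard_coe_finset]
    exact (Set.ncard_le_ncard hx).trans (hD x)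

/-- A tree decomposition with bags of size at most `k` has a colouring with `k` colours that is
injective on every bag. -/
theorem exists_coloring [Finite V] (D : TreeDecomposition G T) {k : ℕ} [NeZero k]
    (hD : ∀ x, {v | x ∈ D.B v}.ncard ≤ k) :
    ∃ c : V → Fin k, ∀ u v, (D.B u ∩ D.B v).Nonempty → c u = c v → u = v := by
  classical
  have := Fintype.ofFinite V
  obtain ⟨d, t, ht, htop⟩ := D.exists_depth
  suffices h : ∀ s : Finset V, ∃ c : V → Fin k, ∀ u ∈ s, ∀ v ∈ s,
      (D.B u ∩ D.B v).Nonempty → c u = c v → u = v by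
    obtain ⟨c, hc⟩ := h Finset.univ
    exact ⟨c, fun u v => hc u (Finset.mem_univ u) v (Finset.mem_univ v)⟩
  intro s
  induction s using Finset.induction_on_max_value d with
  | empty => exact ⟨fun _ => 0, by simp⟩
  | insert a s has hmax ih =>
    obtain ⟨c, hc⟩ := ih
    -- `a` is deepest so far, so `N` and `a` all lie in the bag of `t a`; hence at most `k - 1`
    -- colours are blocked.
    set N := s.filter fun u => (D.B u ∩ D.B a).Nonempty
    have hN : N.card < k := by
      have h1 : insert a N ⊆ Finset.univ.filter fun v => t a ∈ D.B v := by
        intro u hu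
        rw [Finset.mem_filter]
        refine ⟨Finset.mem_univ u, ?_⟩
        rcases Finset.mem_insert.mp hu with rfl | hu
        · exact ht u
        · obtain ⟨hu, hua⟩ := Finset.mem_filter.mp hu
          exact htop u a hua (hmax u hu)
      have h2 := Finset.card_le_card h1
      have haN : a ∉ N := fun h => has (Finset.mem_filter.mp h).1
      rw [Finset.card_insert_of_notMem haN] at h2
      have h3 := hD (t a)
      have h4 : {v | t a ∈ D.B v} = ↑(Finset.univ.filter fun v => t a ∈ D.B v) := by
        ext; simp
      rw [h4, Set.ncard_coe_finset] at h3
      omega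
    obtain ⟨i, hi⟩ : ∃ i, i ∉ N.image c := by
      by_contra! h
      have h1 := Finset.card_le_card (fun i _ => h i : Finset.univ ⊆ N.image c)
      rw [Finset.card_univ, Fintype.card_fin] at h1
      have := Finset.card_image_le (s := N) (f := c)
      omega
    have hi' : ∀ u ∈ s, (D.B u ∩ D.B a).Nonempty → c u ≠ i := fun u hu hua h =>
      hi (Finset.mem_image.mpr ⟨u, Finset.mem_filter.mpr ⟨hu, hua⟩, h⟩)
    refine ⟨Function.update c a i, fun u hu v hv huv h => ?_⟩
    rw [Finset.mem_insert] at hu hv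
    by_cases hua : u = a <;> by_cases hva : v = a
    · rw [hua, hva]
    · subst hua
      rw [Function.update_self, Function.update_of_ne hva] at h
      exact absurd h.symm (hi' v (hv.resolve_left hva) (Set.inter_comm _ _ ▸ huv))
    · subst hva
      rw [Function.update_self, Function.update_of_ne hua] at h
      exact absurd h (hi' u (hu.resolve_left hua) huv)
    · rw [Function.update_of_ne hua, Function.update_of_ne hva] at h
      exact hc u (hu.resolve_left hua) v (hv.resolve_left hva) huv h

end TreeDecomposition

/-! ### Forests as graphs of degeneracy at most one. -/

/-- Every non-empty subset `Y` of `X` has a vertex with at most one neighbour in `Y`. -/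
def InducesForest {V : Type u} (G : SimpleGraph V) (X : Set V) : Prop :=
  ∀ Y ⊆ X, Y.Nonempty → ∃ v ∈ Y, ∀ x ∈ Y, ∀ y ∈ Y, G.Adj v x → G.Adj v y → x = y

theorem InducesForest.mono {V : Type u} {G : SimpleGraph V} {X Y : Set V} (h : InducesForest G X)
    (hYX : Y ⊆ X) : InducesForest G Y :=
  fun Z hZ => h Z (hZ.trans hYX)

/-- On the vertex set of a cycle every vertex would have two neighbours. -/
theorem InducesForest.isAcyclic {V : Type u} {G : SimpleGraph V} {X : Set V}
    (h : InducesForest G X) : (G.induce X).IsAcyclic := by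
  intro v p hp
  obtain ⟨w, ⟨w', hw', rfl⟩, hw⟩ := h (Subtype.val '' {x | x ∈ p.support})
    (by rintro _ ⟨x, -, rfl⟩; exact x.2) ⟨v, v, p.start_mem_support, rfl⟩
  have h2 := hp.ncard_neighborSet_toSubgraph_eq_two hw'
  obtain ⟨x, y, hxy, hN⟩ := Set.ncard_eq_two.mp h2
  have hx : p.toSubgraph.Adj w' x := by
    have : x ∈ p.toSubgraph.neighborSet w' := by simp [hN]
    exact this
  have hy : p.toSubgraph.Adj w' y := by
    have : y ∈ p.toSubgraph.neighborSet w' := by simp [hN]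
    exact this
  exact hxy (Subtype.ext (hw x ⟨x, p.mem_verts_toSubgraph.mp hx.snd_mem, rfl⟩
    y ⟨y, p.mem_verts_toSubgraph.mp hy.snd_mem, rfl⟩ hx.adj_sub hy.adj_sub))

/-- The neighbours in `Y` of a deepest vertex of `Y` share the bag of its top node with it, leaving
room for only one. -/
theorem TreeDecomposition.inducesForest {V : Type u} [Finite V] {ι : Type}
    {G : SimpleGraph V} {T : SimpleGraph ι} (D : TreeDecomposition G T) {X : Set V}
    (hX : ∀ x, ({v | x ∈ D.B v} ∩ X).ncard ≤ 2) : InducesForest G X := by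
  obtain ⟨d, t, ht, htop⟩ := D.exists_depth
  intro Y hYX hY
  obtain ⟨v, hv, hmax⟩ := Y.exists_max_image d Y.toFinite hY
  refine ⟨v, hv, fun x hx y hy hvx hvy => ?_⟩
  by_contra hxy
  have h1 : ({v, x, y} : Set V) ⊆ {w | t v ∈ D.B w} ∩ X := by
    rintro w (rfl | rfl | rfl)
    · exact ⟨ht w, hYX hv⟩
    · exact ⟨htop _ _ (D.meet _ _ hvx.symm) (hmax _ hx), hYX hx⟩
    · exact ⟨htop _ _ (D.meet _ _ hvy.symm) (hmax _ hy), hYX hy⟩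
  have h2 := (Set.ncard_le_ncard h1).trans (hX (t v))
  rw [Set.ncard_eq_three.mpr ⟨v, x, y, hvx.ne, hvy.ne, hxy, rfl⟩] at h2
  omega

/-! ### Edge contraction on a fixed vertex type. -/

namespace SimpleGraph

variable {V : Type u} {G : SimpleGraph V} {a b : V}

/-- The contraction of the edge `ab` of `G` to the vertex `a`; the vertex `b` becomes isolated. -/
def contract (G : SimpleGraph V) (a b : V) : SimpleGraph V where
  Adj x y := x ≠ y ∧ x ≠ b ∧ y ≠ b ∧ (G.Adj x y ∨ x = a ∧ G.Adj b y ∨ y = a ∧ G.Adj x b)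
  symm := ⟨by
    rintro x y ⟨h1, h2, h3, h4⟩
    refine ⟨h1.symm, h3, h2, ?_⟩
    rcases h4 with h | ⟨h, h'⟩ | ⟨h, h'⟩
    · exact .inl h.symm
    · exact .inr (.inr ⟨h, h'.symm⟩)
    · exact .inr (.inl ⟨h, h'.symm⟩)⟩
  loopless := ⟨fun _ h => h.1 rfl⟩

theorem contract_adj {x y : V} : (G.contract a b).Adj x y ↔
    x ≠ y ∧ x ≠ b ∧ y ≠ b ∧ (G.Adj x y ∨ x = a ∧ G.Adj b y ∨ y = a ∧ G.Adj x b) := Iff.rfl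

theorem contract_adj_of_ne {x y : V} (hx : x ≠ a) (hx' : x ≠ b) (hy : y ≠ a) (hy' : y ≠ b) :
    (G.contract a b).Adj x y ↔ G.Adj x y := by
  rw [contract_adj]
  refine ⟨fun h => ?_, fun h => ⟨h.ne, hx', hy', .inl h⟩⟩
  tauto

theorem contract_adj_left {x : V} (hab : a ≠ b) (hx : x ≠ a) (hx' : x ≠ b) :
    (G.contract a b).Adj x a ↔ G.Adj x a ∨ G.Adj x b := by
  rw [contract_adj]
  tauto

/-- `G` has a tree decomposition with bags of size at most `k`. -/
def HasBagsOfSize (k : ℕ) (G : SimpleGraph V) : Prop :=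
  ∃ (ι : Type) (T : SimpleGraph ι) (D : TreeDecomposition G T), ∀ x, {v | x ∈ D.B v}.ncard ≤ k

/-- The merged vertex receives the union of the two node sets. The isolated `b` still needs a node;
a common node `y` of `a` and `b` costs nothing, since its bag already contained both. -/
theorem HasBagsOfSize.contract [Finite V] {k : ℕ} (h : G.HasBagsOfSize k) (hab : G.Adj a b) :
    (G.contract a b).HasBagsOfSize k := by
  classical
  obtain ⟨ι, T, D, hD⟩ := h
  obtain ⟨y, hya, hyb⟩ := D.meet a b hab
  let B : V → Set ι := fun v => if v = b then {y} else if v = a then D.B a ∪ D.B b else D.B v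
  have hBb : B b = {y} := if_pos rfl
  have hBa : B a = D.B a ∪ D.B b := by simp [B, hab.ne]
  have hB : ∀ v, v ≠ a → v ≠ b → B v = D.B v := fun v h1 h2 => by simp [B, h1, h2]
  have hsub : ∀ v, v ≠ b → D.B v ⊆ B v := by
    intro v hv
    by_cases hva : v = a
    · rw [hva, hBa]
      exact Set.subset_union_left
    · rw [hB v hva hv]
  have hsub' : D.B b ⊆ B a := by
    rw [hBa]
    exact Set.subset_union_right
  refine ⟨ι, T, ⟨D.isTree, B, fun v => ?_, fun u v huv => ?_⟩, fun x => ?_⟩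
  · by_cases hvb : v = b
    · rw [hvb, hBb]
      have : Nonempty ({y} : Set ι) := ⟨⟨y, rfl⟩⟩
      exact ⟨Preconnected.of_subsingleton⟩
    · by_cases hva : v = a
      · rw [hva, hBa]
        exact induce_union_connected (D.connected a).preconnected (D.connected b).preconnected
          ⟨y, hya, hyb⟩
      · rw [hB v hva hvb]
        exact D.connected v
  · obtain ⟨-, hu, hv, h | ⟨rfl, h⟩ | ⟨rfl, h⟩⟩ := huv
    · exact (D.meet u v h).mono (Set.inter_subset_inter (hsub u hu) (hsub v hv))
    · exact (D.meet _ _ h).mono (Set.inter_subset_inter hsub' (hsub v hv))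
    · exact (D.meet _ _ h).mono (Set.inter_subset_inter (hsub u hu) hsub')
  · change {v | x ∈ B v}.ncard ≤ k
    by_cases hxy : x = y
    · subst hxy
      refine (Set.ncard_le_ncard fun v hv => ?_).trans (hD x)
      rw [Set.mem_ofPred_eq] at hv ⊢
      by_cases hvb : v = b
      · exact hvb ▸ hyb
      · by_cases hva : v = a
        · exact hva ▸ hya
        · rwa [hB v hva hvb] at hv
    · refine (Set.ncard_le_ncard (t := (fun v => if v = b then a else v) '' {v | x ∈ D.B v})
        fun v hv => ?_).trans ((Set.ncard_image_le (Set.toFinite _)).trans (hD x))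
      rw [Set.mem_ofPred_eq] at hv
      by_cases hvb : v = b
      · rw [hvb, hBb] at hv
        exact absurd hv hxy
      · by_cases hva : v = a
        · subst hva
          rw [hBa] at hv
          rcases hv with hv | hv
          · exact ⟨v, hv, if_neg hvb⟩
          · exact ⟨b, hv, if_pos rfl⟩
        · rw [hB v hva hvb] at hv
          exact ⟨v, hv, if_neg hvb⟩

theorem support_contract_ssubset (hab : G.Adj a b) : (G.contract a b).support ⊂ G.support := by
  refine Set.ssubset_iff_of_subset ?_ |>.mpr ⟨b, ⟨a, hab.symm⟩, fun ⟨y, h⟩ => h.2.1 rfl⟩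
  rintro x ⟨y, -, -, -, h | ⟨rfl, -⟩ | ⟨-, h⟩⟩
  · exact ⟨y, h⟩
  · exact ⟨b, hab⟩
  · exact ⟨b, h⟩

end SimpleGraph

/-- Vertex sets inducing forests lift from the contraction of an edge in no triangle. -/
theorem InducesForest.of_contract {V : Type u} {G : SimpleGraph V} {a b : V} (hab : G.Adj a b)
    (htri : ∀ x, G.Adj a x → ¬ G.Adj b x) {X : Set V} (hX : a ∈ X ↔ b ∈ X)
    (h : InducesForest (G.contract a b) X) : InducesForest G X := by
  intro Y hYX hY
  by_cases hb : b ∈ Y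
  swap
  · obtain ⟨v, hv, hv'⟩ := h Y hYX hY
    have hne : ∀ z ∈ Y, z ≠ b := fun z hz h => hb (h ▸ hz)
    exact ⟨v, hv, fun x hx y hy hvx hvy => hv' x hx y hy
      ⟨hvx.ne, hne v hv, hne x hx, .inl hvx⟩ ⟨hvy.ne, hne v hv, hne y hy, .inl hvy⟩⟩
  -- A vertex of degree at most one is sought in the image of `Y` under the contraction.
  obtain ⟨v, hv, hv'⟩ := h (insert a (Y \ {b}))
    (by
      rintro z (rfl | hz)
      · exact hX.mpr (hYX hb)
      · exact hYX hz.1) ⟨a, .inl rfl⟩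
  have hmem : ∀ z ∈ Y, z ≠ b → z ∈ insert a (Y \ {b}) := fun z hz h => .inr ⟨hz, h⟩
  by_cases hva : v = a
  · subst hva
    have key : ∀ x ∈ Y, x ≠ v → x ≠ b → (G.Adj v x ∨ G.Adj b x) → ∀ y ∈ Y, y ≠ v → y ≠ b →
        (G.Adj v y ∨ G.Adj b y) → x = y := by
      intro x hx hxv hxb h1 y hy hyv hyb h2
      refine hv' x (hmem x hx hxb) y (hmem y hy hyb) ?_ ?_
      · exact ((contract_adj_left hab.ne hxv hxb).mpr (h1.imp .symm .symm)).symm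
      · exact ((contract_adj_left hab.ne hyv hyb).mpr (h2.imp .symm .symm)).symm
    -- The merged vertex has at most one neighbour in `Y` outside the pair, and it is not adjacent
    -- to both ends; so one of the two ends has degree at most one in `Y`.
    by_cases hex : ∃ x ∈ Y, x ≠ v ∧ x ≠ b ∧ G.Adj b x
    · obtain ⟨z, hz, hzv, hzb, hbz⟩ := hex
      by_cases hvY : v ∈ Y
      · have hone : ∀ x ∈ Y, G.Adj v x → x = b := by
          intro x hx hvx
          by_contra hxb
          have := key x hx hvx.ne' hxb (.inl hvx) z hz hzv hzb (.inr hbz)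
          exact htri x hvx (this ▸ hbz)
        exact ⟨v, hvY, fun x hx y hy hvx hvy => (hone x hx hvx).trans (hone y hy hvy).symm⟩
      · have hne : ∀ x ∈ Y, x ≠ v := fun x hx h => hvY (h ▸ hx)
        exact ⟨b, hb, fun x hx y hy hbx hby => key x hx (hne x hx) hbx.ne' (.inr hbx)
          y hy (hne y hy) hby.ne' (.inr hby)⟩
    · push Not at hex
      have hone : ∀ x ∈ Y, G.Adj b x → x = v := by
        intro x hx hbx
        by_contra hxv
        exact hex x hx hxv hbx.ne' hbx
      exact ⟨b, hb, fun x hx y hy hvx hvy => (hone x hx hvx).trans (hone y hy hvy).symm⟩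
  · obtain ⟨hvY, hvb⟩ : v ∈ Y \ {b} := hv.resolve_left hva
    refine ⟨v, hvY, fun x hx y hy hvx hvy => ?_⟩
    have hadj : ∀ z, z ≠ b → G.Adj v z → (G.contract a b).Adj v z :=
      fun z hz h => ⟨h.ne, hvb, hz, .inl h⟩
    have hadja : G.Adj v b → (G.contract a b).Adj v a :=
      fun h => (contract_adj_left hab.ne hva hvb).mpr (.inr h)
    -- If exactly one of two neighbours of `v` is `b`, the other must be `a`, and `v` would complete
    -- a triangle on `ab`.
    by_cases hxb : x = b <;> by_cases hyb : y = b
    · rw [hxb, hyb]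
    · subst hxb
      have := hv' a (.inl rfl) y (hmem y hy hyb) (hadja hvx) (hadj y hyb hvy)
      exact absurd hvx.symm (htri v (this ▸ hvy.symm))
    · subst hyb
      have := hv' x (hmem x hx hxb) a (.inl rfl) (hadj x hxb hvx) (hadja hvy)
      exact absurd hvy.symm (htri v (this ▸ hvx.symm))
    · exact hv' x (hmem x hx hxb) y (hmem y hy hyb) (hadj x hxb hvx) (hadj y hyb hvy)

/-! ### Contractible edges and the structure forced by their absence. -/

namespace SimpleGraph

variable {V : Type u} {G : SimpleGraph V} {a b : V} {S : Set V}

theorem HasBagsOfSize.card_le_of_clique [Finite V] {k : ℕ} (h : G.HasBagsOfSize k) {s : Finset V}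
    (hs : ∀ u ∈ s, ∀ v ∈ s, u ≠ v → G.Adj u v) : s.card ≤ k := by
  obtain ⟨ι, T, D, hD⟩ := h
  exact D.card_le_of_clique hD hs

theorem HasBagsOfSize.not_four_clique [Finite V] (h : G.HasBagsOfSize 3) {p q r s : V}
    (hpq : G.Adj p q) (hpr : G.Adj p r) (hps : G.Adj p s) (hqr : G.Adj q r) (hqs : G.Adj q s) :
    ¬ G.Adj r s := by
  classical
  intro hrs
  have h1 := h.card_le_of_clique (s := {p, q, r, s}) (by
    simp only [Finset.mem_insert, Finset.mem_singleton]
    rintro u (rfl | rfl | rfl | rfl) v (rfl | rfl | rfl | rfl) huv <;>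
      first | exact absurd rfl huv | assumption | (apply Adj.symm; assumption))
  rw [Finset.card_eq_of_equiv_fin (n := 4)] at h1
  · omega
  · refine Finset.equivFinOfCardEq ?_
    rw [Finset.card_insert_of_notMem, Finset.card_insert_of_notMem, Finset.card_pair hrs.ne] <;>
      simp [hpq.ne, hpr.ne, hps.ne, hqr.ne, hqs.ne]

/-- Some third vertex is adjacent to exactly one of `u` and `v`. -/
def Distinguished (G : SimpleGraph V) (u v : V) : Prop :=
  ∃ w, w ≠ u ∧ w ≠ v ∧ ¬ (G.Adj u w ↔ G.Adj v w)

/-- The edge `ab` is in no triangle, and its contraction leaves every distinguished edge between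
vertices outside of `S ∪ {a, b}` distinguished. -/
def Contractible (G : SimpleGraph V) (S : Set V) (a b : V) : Prop :=
  G.Adj a b ∧ (∀ x, G.Adj a x → ¬ G.Adj b x) ∧
    ∀ u v, u ∉ S → v ∉ S → u ≠ a → u ≠ b → v ≠ a → v ≠ b → G.Adj u v →
      G.Distinguished u v → (G.contract a b).Distinguished u v

/-- The obstruction to contractibility: an edge `pq` opposite to `ab` in a four-cycle whose ends
have the same neighbours outside of the cycle. -/
theorem exists_square_of_not_contractible (hab : G.Adj a b)
    (htri : ∀ x, G.Adj a x → ¬ G.Adj b x) (h : ¬ G.Contractible S a b) :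
    ∃ p q, p ≠ b ∧ q ≠ a ∧ G.Adj a p ∧ G.Adj b q ∧ G.Adj p q ∧ ¬ G.Adj b p ∧ ¬ G.Adj a q ∧
      ∀ x, x ≠ a → x ≠ b → x ≠ p → x ≠ q → (G.Adj p x ↔ G.Adj q x) := by
  simp only [Contractible, not_and, not_forall] at h
  obtain ⟨u, v, -, -, hua, hub, hva, hvb, huv, ⟨w, hwu, hwv, hw⟩, hn⟩ := h hab htri
  have htwin : ∀ x, x ≠ u → x ≠ v → ((G.contract a b).Adj u x ↔ (G.contract a b).Adj v x) := by
    intro x hxu hxv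
    by_contra hx
    exact hn ⟨x, hxu, hxv, hx⟩
  have hout : ∀ x, x ≠ a → x ≠ b → x ≠ u → x ≠ v → (G.Adj u x ↔ G.Adj v x) := by
    intro x hxa hxb hxu hxv
    have := htwin x hxu hxv
    rwa [contract_adj_of_ne hua hub hxa hxb, contract_adj_of_ne hva hvb hxa hxb] at this
  have hin : (G.Adj u a ∨ G.Adj u b) ↔ (G.Adj v a ∨ G.Adj v b) := by
    have := htwin a hua.symm hva.symm
    rwa [contract_adj_left hab.ne hua hub, contract_adj_left hab.ne hva hvb] at this
  -- Only adjacency to `a` or `b` can be lost as a distinction, so `u` and `v` attach to different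
  -- ends of `ab`.
  have hwab : w = a ∨ w = b := by
    by_contra! hne
    exact hw (hout w hne.1 hne.2 hwu hwv)
  have h1 : ¬ (G.Adj u a ∧ G.Adj u b) := fun h => htri u h.1.symm h.2.symm
  have h2 : ¬ (G.Adj v a ∧ G.Adj v b) := fun h => htri v h.1.symm h.2.symm
  have hcases : (G.Adj u a ∧ G.Adj v b) ∨ (G.Adj v a ∧ G.Adj u b) := by
    rcases hwab with rfl | rfl <;> tauto
  rcases hcases with ⟨h3, h4⟩ | ⟨h3, h4⟩
  · exact ⟨u, v, hub, hva, h3.symm, h4.symm, huv, fun h => htri u h3.symm h, fun h => htri v h h4.symm, hout⟩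
  · exact ⟨v, u, hvb, hua, h3.symm, h4.symm, huv.symm, fun h => htri v h3.symm h,
      fun h => htri u h h4.symm, fun x h1 h2 h3 h4 => (hout x h1 h2 h4 h3).symm⟩

/-- If no edge is contractible, then the ends of an edge `ab` in no triangle have degree two and
belong to a common four-cycle. -/
theorem exists_square_of_forall_not_contractible [Finite V] (hG : G.HasBagsOfSize 3)
    (hn : ∀ a b, ¬ G.Contractible S a b) (hab : G.Adj a b)
    (htri : ∀ x, G.Adj a x → ¬ G.Adj b x) :
    ∃ p q, G.Adj a p ∧ G.Adj b q ∧ G.Adj p q ∧ q ≠ a ∧ p ≠ b ∧ ∀ x, G.Adj a x → x = b ∨ x = p := by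
  obtain ⟨p, q, hpb, hqa, hap, hbq, hpq, hbp, haq, hout⟩ :=
    exists_square_of_not_contractible hab htri (hn a b)
  -- Otherwise `p`, `q`, `k` and the merged vertex form a four-clique after contracting `ab`, too
  -- large for bags of size three.
  have hcommon : ∀ k, G.Adj p k → G.Adj q k → ¬ G.Adj a k ∧ ¬ G.Adj b k := by
    intro k hpk hqk
    have hka : k ≠ a := fun h => haq (h ▸ hqk.symm)
    have hkb : k ≠ b := fun h => hbp (h ▸ hpk.symm)
    rw [← not_or]
    intro hk
    refine (hG.contract hab).not_four_clique (p := p) (q := q) (r := k) (s := a) ?_ ?_ ?_ ?_ ?_ ?_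
    · rwa [contract_adj_of_ne hap.ne' hpb hqa hbq.ne']
    · rwa [contract_adj_of_ne hap.ne' hpb hka hkb]
    · exact (contract_adj_left hab.ne hap.ne' hpb).mpr (.inl hap.symm)
    · rwa [contract_adj_of_ne hqa hbq.ne' hka hkb]
    · exact (contract_adj_left hab.ne hqa hbq.ne').mpr (.inr hbq.symm)
    · exact (contract_adj_left hab.ne hka hkb).mpr (hk.imp .symm .symm)
  -- Given a common neighbour `k`, the edge `pa` is in no triangle, so its contraction is blocked by
  -- a second square. Its outside-twin condition and that of the first square force `p` to be
  -- adjacent to `q'`.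
  have hdisj : ∀ k, G.Adj p k → ¬ G.Adj q k := by
    intro k hpk hqk
    obtain ⟨hak, hbk⟩ := hcommon k hpk hqk
    have htri' : ∀ x, G.Adj p x → ¬ G.Adj a x := by
      intro x hpx hax
      have hxb : x ≠ b := fun h => hbp (h ▸ hpx.symm)
      have hxq : x ≠ q := fun h => haq (h ▸ hax)
      exact (hcommon x hpx ((hout x hax.ne' hxb hpx.ne' hxq).mp hpx)).1 hax
    obtain ⟨p', q', hpa', hqp', hpp', haq', hpq', hap', hpq'', hout'⟩ :=
      exists_square_of_not_contractible hap.symm htri' (hn p a)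
    have hq'b : ∀ x, G.Adj q' x → ¬ G.Adj b x → q' ≠ b := by
      rintro x h h' rfl
      exact h' h
    have hkq' : k ≠ q' := fun h => hak (h ▸ haq')
    have hq'q : q' ≠ q := fun h => haq (h ▸ haq')
    by_cases hp'q : p' = q
    · subst hp'q
      have h1 := (hout' k hpk.ne' (fun h => haq (h ▸ hqk.symm)) hqk.ne' hkq').mp hqk
      exact hpq'' ((hout q' haq'.ne' (hq'b k h1 hbk) hqp' hq'q).mpr hpq')
    · have hqp : G.Adj q p' :=
        (hout p' hpa' (fun h => hbp (h ▸ hpp'.symm)) hpp'.ne' hp'q).mp hpp'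
      have h1 := (hout' q hpq.ne' hqa (Ne.symm hp'q) hq'q.symm).mp hqp.symm
      exact hpq'' ((hout q' haq'.ne' (hq'b p' hpq'.symm (hcommon p' hpp' hqp).2) hqp' hq'q).mpr
        h1.symm)
  -- The square blocking `pq` must be the same four-cycle. Hence `a` and `b` are twins outside it,
  -- and as they have no common neighbour, they have no neighbours there.
  obtain ⟨p', q', hpq', hqp', hpp', hqq', -, hqp'', hpq'', hout'⟩ :=
    exists_square_of_not_contractible hpq hdisj (hn p q)
  have h1 : p' = a := by
    by_contra h
    exact hqp'' ((hout p' h (fun h => hbp (h ▸ hpp'.symm)) hpp'.ne' hpq').mp hpp')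
  have h2 : q' = b := by
    by_contra h
    exact hpq'' ((hout q' (fun h => haq (h ▸ hqq'.symm)) h hqp' hqq'.ne').mpr hqq')
  subst h1 h2
  refine ⟨p, q, hap, hbq, hpq, hqa, hpb, fun x hax => ?_⟩
  by_contra! hx
  exact htri x hax ((hout' x hx.2 (fun h => haq (h ▸ hax)) hax.ne' hx.1).mp hax)

/-! ### Good colourings with three colours. -/

/-- The endpoints of an edge `uv` have the same colour, or some third vertex adjacent to `u` or `v`
has the colour of `u` or `v`. -/
def GoodEdge (G : SimpleGraph V) {α : Type*} (c : V → α) (u v : V) : Prop :=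
  c u = c v ∨ ∃ z, z ≠ u ∧ z ≠ v ∧ (G.Adj u z ∨ G.Adj v z) ∧ (c z = c u ∨ c z = c v)

theorem GoodEdge.symm {α : Type*} {c : V → α} {u v : V} (h : G.GoodEdge c u v) :
    G.GoodEdge c v u := by
  obtain h | ⟨z, h1, h2, h3, h4⟩ := h
  · exact .inl h.symm
  · exact .inr ⟨z, h2, h1, h3.symm, h4.symm⟩

theorem Distinguished.symm {u v : V} (h : G.Distinguished u v) : G.Distinguished v u := by
  obtain ⟨w, h1, h2, h3⟩ := h
  exact ⟨w, h2, h1, fun h => h3 h.symm⟩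

theorem eq_or_eq_of_fin_three : ∀ {i j k l : Fin 3}, i ≠ j → i ≠ k → j ≠ k → l ≠ i →
    l = j ∨ l = k := by
  decide

theorem goodEdge_of_forall_not_contractible [Finite V] (hG : G.HasBagsOfSize 3)
    (hn : ∀ a b, ¬ G.Contractible S a b) {c : V → Fin 3} (hc : ∀ u v, G.Adj u v → c u ≠ c v)
    {u v w : V} (huv : G.Adj u v) (huw : G.Adj u w) (hwv : w ≠ v) (hvw : ¬ G.Adj v w) :
    G.GoodEdge c u v := by
  right
  by_cases htri : ∃ y, G.Adj u y ∧ G.Adj w y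
  · obtain ⟨y, huy, hwy⟩ := htri
    rcases eq_or_eq_of_fin_three (hc u w huw) (hc u y huy) (hc w y hwy) (hc u v huv).symm with h | h
    · exact ⟨w, huw.ne', hwv, .inl huw, .inr h.symm⟩
    · exact ⟨y, huy.ne', fun h => hvw (h ▸ hwy.symm), .inl huy, .inr h.symm⟩
  · push Not at htri
    obtain ⟨p, q, hup, hwq, hpq, hqu, hpw, hu⟩ :=
      exists_square_of_forall_not_contractible hG hn huw htri
    obtain rfl : v = p := (hu v huv).resolve_left hwv.symm
    by_cases hqc : c q = c u
    · exact ⟨q, hqu, hpq.ne', .inr hpq, .inl hqc⟩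
    · rcases eq_or_eq_of_fin_three (Ne.symm hqc) (hc u v hup) (hc v q hpq).symm
        (hc u w huw).symm with h | h
      · exact absurd h (hc w q hwq)
      · exact ⟨w, huw.ne', hwv, .inl huw, .inr h⟩

theorem HasBagsOfSize.exists_coloring [Finite V] {k : ℕ} [NeZero k] (hG : G.HasBagsOfSize k) :
    ∃ c : V → Fin k, (∀ u v, G.Adj u v → c u ≠ c v) ∧
      (∀ s : Finset (Fin k), s.card ≤ 2 → InducesForest G {v | c v ∈ s}) ∧
      ∀ s : Finset (Fin k), (G.induce {v | c v ∈ s}).HasBagsOfSize s.card := by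
  obtain ⟨ι, T, D, hD⟩ := hG
  obtain ⟨c, hc⟩ := D.exists_coloring hD
  have hinj : ∀ x, Set.InjOn c {v | x ∈ D.B v} := fun x u hu v hv h => hc u v ⟨x, hu, hv⟩ h
  have hcard : ∀ (s : Finset (Fin k)) x, ({v | x ∈ D.B v} ∩ {v | c v ∈ s}).ncard ≤ s.card := by
    intro s x
    rw [← Set.ncard_coe_finset]
    exact Set.ncard_le_ncard_of_injOn c (fun v hv => hv.2)
      ((hinj x).mono Set.inter_subset_left)
  refine ⟨c, fun u v huv h => huv.ne (hc u v (D.meet u v huv) h), fun s hs =>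
    D.inducesForest fun x => (hcard s x).trans hs, fun s => ?_⟩
  refine ⟨ι, T, ⟨D.isTree, fun v => D.B v, fun v => D.connected v, fun u v h => D.meet u v h⟩,
    fun x => ?_⟩
  rw [← Set.ncard_image_of_injective _ Subtype.val_injective]
  refine (Set.ncard_le_ncard ?_).trans (hcard s x)
  rintro _ ⟨v, hv, rfl⟩
  exact ⟨hv, v.2⟩

/-- A graph with a tree decomposition into bags of size at most three has a colouring with three
colours such that any two colour classes induce a forest, and every distinguished edge is good. -/
theorem HasBagsOfSize.exists_good_coloring [Finite V] (hG : G.HasBagsOfSize 3) (S : Set V) :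
    ∃ c : V → Fin 3, (∀ k, InducesForest G {v | c v ≠ k}) ∧
      ∀ u v, u ∉ S → v ∉ S → G.Adj u v → G.Distinguished u v → G.GoodEdge c u v := by
  classical
  induction hm : G.support.ncard using Nat.strong_induction_on generalizing G S with
  | _ m ih =>
  subst hm
  by_cases hn : ∃ a b, G.Contractible S a b
  · obtain ⟨a, b, hab, htri, hdist⟩ := hn
    -- Edges at the merged vertex are exempted: after lifting, `b` has the colour of `a`, which
    -- makes all edges at `a` or `b` good.
    obtain ⟨c, hcf, hcg⟩ := ih _ (Set.ncard_lt_ncard (support_contract_ssubset hab))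
      (hG.contract hab) (S ∪ {a}) rfl
    set c' : V → Fin 3 := fun v => if v = b then c a else c v with hc'
    have hc'b : c' b = c a := if_pos rfl
    have hc'n : ∀ v, v ≠ b → c' v = c v := fun v hv => if_neg hv
    refine ⟨c', fun k => ?_, fun u v hu hv huv hd => ?_⟩
    · refine InducesForest.of_contract hab htri (by simp [hc'b, hc'n a hab.ne]) ?_
      intro Y hY hYne
      by_cases hYb : b ∈ Y
      · exact ⟨b, hYb, fun x _ y _ hx => absurd rfl hx.2.1⟩
      · refine hcf k Y (fun v hv => ?_) hYne
        have := hY hv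
        rwa [Set.mem_ofPred_eq, hc'n v fun h => hYb (h ▸ hv)] at this
    · have hhappy : ∀ x, (G.Adj a x → G.GoodEdge c' a x) ∧ (G.Adj b x → G.GoodEdge c' b x) := by
        have hab' : c' b = c' a := by rw [hc'b, hc'n a hab.ne]
        refine fun x => ⟨fun h => ?_, fun h => ?_⟩
        · by_cases hx : x = b
          · exact .inl (hx ▸ hab'.symm)
          · exact .inr ⟨b, hab.ne', Ne.symm hx, .inl hab, .inl hab'⟩
        · by_cases hx : x = a
          · exact .inl (hx ▸ hab')
          · exact .inr ⟨a, hab.ne, Ne.symm hx, .inl hab.symm, .inl hab'.symm⟩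
      by_cases hua : u = a
      · subst hua; exact (hhappy v).1 huv
      by_cases hub : u = b
      · subst hub; exact (hhappy v).2 huv
      by_cases hva : v = a
      · subst hva; exact ((hhappy u).1 huv.symm).symm
      by_cases hvb : v = b
      · subst hvb; exact ((hhappy u).2 huv.symm).symm
      have hgood := hcg u v (by simp [hu, hua]) (by simp [hv, hva])
        ((contract_adj_of_ne hua hub hva hvb).mpr huv) (hdist u v hu hv hua hub hva hvb huv hd)
      rw [GoodEdge, hc'n u hub, hc'n v hvb]
      refine hgood.imp_right ?_
      rintro ⟨z, hzu, hzv, hz, hzc⟩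
      have hzb : z ≠ b := by
        rcases hz with h | h <;> exact h.2.2.1
      by_cases hza : z = a
      · subst hza
        rw [contract_adj_left hab.ne hua hub, contract_adj_left hab.ne hva hvb] at hz
        by_cases h : G.Adj u z ∨ G.Adj v z
        · exact ⟨z, hzu, hzv, h, by rwa [hc'n z hzb]⟩
        · exact ⟨b, Ne.symm hub, Ne.symm hvb, by tauto, by rwa [hc'b]⟩
      · rw [contract_adj_of_ne hua hub hza hzb, contract_adj_of_ne hva hvb hza hzb] at hz
        exact ⟨z, hzu, hzv, hz, by rwa [hc'n z hzb]⟩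
  · push Not at hn
    obtain ⟨c, hc, hcf, -⟩ := hG.exists_coloring
    refine ⟨c, fun k => ?_, ?_⟩
    · have := hcf (Finset.univ.erase k) (by simp)
      simpa using this
    · rintro u v - - huv ⟨w, hwu, hwv, hw⟩
      by_cases huw : G.Adj u w
      · exact goodEdge_of_forall_not_contractible hG hn hc huv huw hwv (by tauto)
      · exact (goodEdge_of_forall_not_contractible hG hn hc huv.symm (by tauto) hwu huw).symm

end SimpleGraph

/-! ### Strong forests, valid edges and the upper bounds. -/

section StrongForests

variable {V : Type u} {G : SimpleGraph V}

theorem InducesForest.of_induce {A : Set V} {X : Set A} (h : InducesForest (G.induce A) X) :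
    InducesForest G (Subtype.val '' X) := by
  rintro Y hY ⟨y, hy⟩
  have hYA : ∀ z ∈ Y, ∃ z' : A, z' ∈ X ∧ z'.1 = z := fun z hz => hY hz
  obtain ⟨y', -, rfl⟩ := hYA y hy
  obtain ⟨v, hv, hv'⟩ := h (Subtype.val ⁻¹' Y) (fun z hz => by
    obtain ⟨z', hz', h⟩ := hYA z.1 hz
    exact Subtype.ext h ▸ hz') ⟨y', hy⟩
  refine ⟨v.1, hv, fun x hx z hz hvx hvz => ?_⟩
  obtain ⟨x', -, rfl⟩ := hYA x hx
  obtain ⟨z', -, rfl⟩ := hYA z hz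
  exact congrArg _ (hv' x' hx z' hz hvx hvz)

/-- The vertices of `X` that are not isolated in the subgraph induced by `X` form a strong forest,
if `X` induces a forest. -/
theorem InducesForest.isStrongForest_one [Finite V] {X : Set V} (h : InducesForest G X) :
    IsStrongForest G 1 {v ∈ X | ∃ w ∈ X, G.Adj v w} := by
  refine ⟨(h.mono fun v hv => hv.1).isAcyclic, fun c => ?_⟩
  induction c using ConnectedComponent.ind with
  | _ v =>
  obtain ⟨v, hv, w, hw, hvw⟩ := v
  have hadj : (G.induce {v ∈ X | ∃ w ∈ X, G.Adj v w}).Adj ⟨v, hv, w, hw, hvw⟩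
    ⟨w, hw, v, hv, hvw.symm⟩ := hvw
  refine (Set.ncard_pos (Set.toFinite _)).mpr ⟨s(⟨_, rfl⟩, ⟨⟨w, hw, v, hv, hvw.symm⟩, ?_⟩), ?_⟩
  · exact ConnectedComponent.sound hadj.reachable.symm
  · exact hadj

/-- The vertices of `X` on paths with two edges in the subgraph induced by `X` form a `2`-strong
forest, if `X` induces a forest. -/
theorem InducesForest.isStrongForest_two [Finite V] {X : Set V} (h : InducesForest G X) :
    IsStrongForest G 2 {v | ∃ x ∈ X, ∃ y ∈ X, ∃ z ∈ X, x ≠ z ∧ G.Adj x y ∧ G.Adj y z ∧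
      (v = x ∨ v = y ∨ v = z)} := by
  set A := {v | ∃ x ∈ X, ∃ y ∈ X, ∃ z ∈ X, x ≠ z ∧ G.Adj x y ∧ G.Adj y z ∧
      (v = x ∨ v = y ∨ v = z)} with hA
  refine ⟨(h.mono ?_).isAcyclic, fun c => ?_⟩
  · rintro v ⟨x, hx, y, hy, z, hz, -, -, -, rfl | rfl | rfl⟩ <;> assumption
  induction c using ConnectedComponent.ind with
  | _ v =>
  obtain ⟨v, x, hx, y, hy, z, hz, hxz, hxy, hyz, hv⟩ := v
  have hxA : x ∈ A := ⟨x, hx, y, hy, z, hz, hxz, hxy, hyz, by simp⟩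
  have hyA : y ∈ A := ⟨x, hx, y, hy, z, hz, hxz, hxy, hyz, by simp⟩
  have hzA : z ∈ A := ⟨x, hx, y, hy, z, hz, hxz, hxy, hyz, by simp⟩
  have h1 : (G.induce A).Adj ⟨x, hxA⟩ ⟨y, hyA⟩ := hxy
  have h2 : (G.induce A).Adj ⟨y, hyA⟩ ⟨z, hzA⟩ := hyz
  generalize hvA : (⟨v, _⟩ : A) = v'
  have hc : (G.induce A).connectedComponentMk v' = (G.induce A).connectedComponentMk ⟨y, hyA⟩ := by
    subst hvA
    rcases hv with rfl | rfl | rfl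
    · exact ConnectedComponent.sound h1.reachable
    · rfl
    · exact ConnectedComponent.sound h2.reachable.symm
  rw [hc]
  have hxc := ConnectedComponent.sound h1.reachable
  have hzc := ConnectedComponent.sound h2.reachable.symm
  refine (Set.one_lt_ncard (Set.toFinite _)).mpr
    ⟨s(⟨⟨x, hxA⟩, hxc⟩, ⟨⟨y, hyA⟩, rfl⟩), h1, s(⟨⟨y, hyA⟩, rfl⟩, ⟨⟨z, hzA⟩, hzc⟩), h2, ?_⟩
  intro h
  rcases Sym2.eq_iff.mp h with ⟨h, -⟩ | ⟨h, -⟩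
  · exact hxy.ne (congrArg (fun a => a.1.1) h)
  · exact hxz (congrArg (fun a => a.1.1) h)

theorem IsStrongForest.not_triangle {k : ℕ} {X : Set V} (h : IsStrongForest G k X) {x y z : V}
    (hx : x ∈ X) (hy : y ∈ X) (hz : z ∈ X) (hxy : G.Adj x y) (hxz : G.Adj x z) :
    ¬ G.Adj y z := by
  classical
  intro hyz
  refine h.1.cliqueFree le_rfl {⟨x, hx⟩, ⟨y, hy⟩, ⟨z, hz⟩} ?_
  rw [is3Clique_triple_iff]
  exact ⟨hxy, hxz, hyz⟩

/-- The ends of a `2`-valid edge are not twins. -/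
theorem IsValidEdge.distinguished {u v : V} (h : IsValidEdge G 2 s(u, v)) :
    G.Adj u v ∧ G.Distinguished u v := by
  obtain ⟨X, hX, huv, hmem⟩ := h
  have hu : u ∈ X := hmem u (by simp)
  have hv : v ∈ X := hmem v (by simp)
  refine ⟨huv, ?_⟩
  by_contra hd
  have htwin : ∀ w, w ≠ u → w ≠ v → (G.Adj u w ↔ G.Adj v w) := by
    intro w h1 h2
    by_contra h3
    exact hd ⟨w, h1, h2, h3⟩
  -- Leaving the twins `u` and `v` would reach a common neighbour, hence a triangle in a forest.
  have hcomp : ∀ x : X, (G.induce X).Reachable ⟨u, hu⟩ x → x.1 = u ∨ x.1 = v := by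
    intro x hx
    rw [reachable_iff_reflTransGen] at hx
    induction hx with
    | refl => exact .inl rfl
    | @tail y z _ hyz ih =>
      by_contra! hz
      have h1 : G.Adj u z.1 ∨ G.Adj v z.1 := by
        rcases ih with h | h
        · exact .inl (h ▸ hyz)
        · exact .inr (h ▸ hyz)
      have h2 := htwin z.1 hz.1 hz.2
      exact hX.not_triangle hu hv z.2 huv (by tauto) (by tauto)
  have hfin := hX.2 ((G.induce X).connectedComponentMk ⟨u, hu⟩)
  -- Finiteness of the edge set follows from its positive `ncard`, which is zero for infinite sets.
  obtain ⟨e, he, f, hf, hef⟩ := (Set.one_lt_ncard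
    (Set.finite_of_ncard_pos (by omega))).mp (Nat.lt_of_succ_le hfin)
  have hval : ∀ x : ((G.induce X).connectedComponentMk ⟨u, hu⟩).supp, x.1.1 = u ∨ x.1.1 = v :=
    fun x => hcomp x.1 (ConnectedComponent.exact x.2).symm
  have hext : ∀ x y : ((G.induce X).connectedComponentMk ⟨u, hu⟩).supp, x.1.1 = y.1.1 → x = y :=
    fun x y h => Subtype.ext (Subtype.ext h)
  induction e with
  | _ a b =>
  induction f with
  | _ c d =>
  have hab : a ≠ b := ((mem_edgeSet _).mp he).ne
  have hcd : c ≠ d := ((mem_edgeSet _).mp hf).ne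
  have ha := hval a
  have hb := hval b
  have hc := hval c
  have hd := hval d
  have hab' : a.1.1 ≠ b.1.1 := fun h => hab (hext _ _ h)
  have hcd' : c.1.1 ≠ d.1.1 := fun h => hcd (hext _ _ h)
  refine hef (Sym2.eq_iff.mpr ?_)
  by_cases hac : a.1.1 = c.1.1
  · exact .inl ⟨hext _ _ hac, hext _ _ (by grind)⟩
  · exact .inr ⟨hext _ _ (by grind), hext _ _ (by grind)⟩

theorem strongInducedArboricity_le_card {ι : Type*} [Fintype ι] {k : ℕ} (F : ι → Set V)
    (hF : ∀ i, IsStrongForest G k (F i))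
    (hcov : ∀ u v, IsValidEdge G k s(u, v) → ∃ i, u ∈ F i ∧ v ∈ F i) :
    strongInducedArboricity k G ≤ Fintype.card ι := by
  refine Nat.sInf_le ⟨fun i => F ((Fintype.equivFin ι).symm i), fun i => hF _, fun e he => ?_⟩
  induction e with
  | _ u v =>
  obtain ⟨i, hu, hv⟩ := hcov u v he
  obtain ⟨X, hX, huv, -⟩ := he
  exact ⟨Fintype.equivFin ι i, huv, by simp [hu, hv]⟩

theorem strongInducedArboricity_one_le [Finite V] {k : ℕ} (hk : 2 ≤ k) (hG : G.HasBagsOfSize k) :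
    strongInducedArboricity 1 G ≤ k.choose 2 := by
  have : NeZero k := ⟨by omega⟩
  obtain ⟨c, hc, hcf, -⟩ := hG.exists_coloring
  have hcard : Fintype.card {s : Finset (Fin k) // s.card = 2} = k.choose 2 := by
    rw [Fintype.card_finset_len, Fintype.card_fin]
  rw [← hcard]
  refine strongInducedArboricity_le_card
    (fun s => {v ∈ {v | c v ∈ s.1} | ∃ w ∈ {v | c v ∈ s.1}, G.Adj v w})
    (fun s => (hcf s.1 s.2.le).isStrongForest_one) ?_
  rintro u v ⟨-, -, huv, -⟩
  have huv : G.Adj u v := huv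
  have hu : c u ∈ ({c u, c v} : Finset (Fin k)) := by simp
  have hv : c v ∈ ({c u, c v} : Finset (Fin k)) := by simp
  exact ⟨⟨{c u, c v}, Finset.card_pair (hc u v huv)⟩, ⟨hu, v, hv, huv⟩, ⟨hv, u, hu, huv.symm⟩⟩

theorem strongInducedArboricity_two_le [Finite V] {k : ℕ} (hk : 3 ≤ k) (hG : G.HasBagsOfSize k) :
    strongInducedArboricity 2 G ≤ 3 * k.choose 3 := by
  classical
  have : NeZero k := ⟨by omega⟩
  obtain ⟨c, hc, -, hcb⟩ := hG.exists_coloring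
  have hcard : Fintype.card ({s : Finset (Fin k) // s.card = 3} × Fin 3) = 3 * k.choose 3 := by
    rw [Fintype.card_prod, Fintype.card_finset_len, Fintype.card_fin, Fintype.card_fin, mul_comm]
  have hex : ∀ s : {s : Finset (Fin k) // s.card = 3}, ∃ c' : {v | c v ∈ s.1} → Fin 3,
      (∀ i, InducesForest (G.induce {v | c v ∈ s.1}) {v | c' v ≠ i}) ∧
      ∀ u v, (G.induce {v | c v ∈ s.1}).Adj u v → (G.induce {v | c v ∈ s.1}).Distinguished u v →
        (G.induce {v | c v ∈ s.1}).GoodEdge c' u v := by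
    rintro ⟨s, hs⟩
    obtain ⟨c', h1, h2⟩ := (hs ▸ hcb s).exists_good_coloring ∅
    exact ⟨c', h1, fun u v => h2 u v (Set.notMem_empty u) (Set.notMem_empty v)⟩
  choose c' hc'f hc'g using hex
  rw [← hcard]
  refine strongInducedArboricity_le_card _
    (fun i : {s : Finset (Fin k) // s.card = 3} × Fin 3 =>
      (hc'f i.1 i.2).of_induce.isStrongForest_two) ?_
  intro u v huv
  obtain ⟨huv, w, hwu, hwv, hw⟩ := huv.distinguished
  -- Including the colour of `w` keeps the edge distinguished in the subgraph induced by the triple.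
  obtain ⟨s, hs, hsc⟩ := Finset.exists_superset_card_eq (s := {c u, c v, c w}) (n := 3)
    Finset.card_le_three (by simpa using hk)
  have hu : c u ∈ s := hs (by simp)
  have hv : c v ∈ s := hs (by simp)
  have hw' : c w ∈ s := hs (by simp)
  set u' : {v | c v ∈ s} := ⟨u, hu⟩
  set v' : {v | c v ∈ s} := ⟨v, hv⟩
  set w' : {v | c v ∈ s} := ⟨w, hw'⟩
  have hgood := hc'g ⟨s, hsc⟩ u' v' huv
    ⟨w', fun h => hwu (congrArg Subtype.val h), fun h => hwv (congrArg Subtype.val h), hw⟩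
  -- A third vertex adjacent to the edge and a colour `i` missed by all three; if the ends have
  -- equal colours, the distinguishing vertex serves as `z`.
  obtain ⟨z, hzu, hzv, hz, i, hi⟩ : ∃ z : {v | c v ∈ s}, z ≠ u' ∧ z ≠ v' ∧
      (G.Adj u z.1 ∨ G.Adj v z.1) ∧ ∃ i : Fin 3, c' ⟨s, hsc⟩ u' ≠ i ∧ c' ⟨s, hsc⟩ v' ≠ i ∧
        c' ⟨s, hsc⟩ z ≠ i := by
    have hthird : ∀ i j : Fin 3, ∃ l, i ≠ l ∧ j ≠ l := by decide
    obtain h | ⟨z, hzu, hzv, hz, hzc⟩ := hgood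
    · obtain ⟨i, h1, h2⟩ := hthird (c' ⟨s, hsc⟩ u') (c' ⟨s, hsc⟩ w')
      exact ⟨w', fun h => hwu (congrArg Subtype.val h), fun h => hwv (congrArg Subtype.val h),
        by tauto, i, h1, h ▸ h1, h2⟩
    · obtain ⟨i, h1, h2⟩ := hthird (c' ⟨s, hsc⟩ u') (c' ⟨s, hsc⟩ v')
      refine ⟨z, hzu, hzv, hz, i, h1, h2, ?_⟩
      rcases hzc with h | h <;> rw [h] <;> assumption
  have hzu' : z.1 ≠ u := fun h => hzu (Subtype.ext h)
  have hzv' : z.1 ≠ v := fun h => hzv (Subtype.ext h)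
  refine ⟨(⟨s, hsc⟩, i), ?_⟩
  have hu' : u ∈ Subtype.val '' {v | c' ⟨s, hsc⟩ v ≠ i} := ⟨u', hi.1, rfl⟩
  have hv' : v ∈ Subtype.val '' {v | c' ⟨s, hsc⟩ v ≠ i} := ⟨v', hi.2.1, rfl⟩
  have hz' : z.1 ∈ Subtype.val '' {v | c' ⟨s, hsc⟩ v ≠ i} := ⟨z, hi.2.2, rfl⟩
  rcases hz with hz | hz
  · exact ⟨⟨v, hv', u, hu', z.1, hz', hzv'.symm, huv.symm, hz, by simp⟩,
      ⟨v, hv', u, hu', z.1, hz', hzv'.symm, huv.symm, hz, by simp⟩⟩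
  · exact ⟨⟨u, hu', v, hv', z.1, hz', hzu'.symm, huv, hz, by simp⟩,
      ⟨u, hu', v, hv', z.1, hz', hzu'.symm, huv, hz, by simp⟩⟩

/-- An edge of an induced path with two edges is `2`-valid. -/
theorem isValidEdge_two_of_path [Finite V] {x y z : V} (hxy : G.Adj x y) (hyz : G.Adj y z)
    (hxz : x ≠ z) (hxz' : ¬ G.Adj x z) : IsValidEdge G 2 s(x, y) := by
  have hX : InducesForest G {x, y, z} := by
    intro Y hY hYne
    by_cases hx : x ∈ Y
    · have h : ∀ w ∈ Y, G.Adj x w → w = y := by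
        intro w hw hxw
        rcases hY hw with rfl | rfl | rfl
        · exact absurd rfl hxw.ne
        · rfl
        · exact absurd hxw hxz'
      exact ⟨x, hx, fun a ha b hb h1 h2 => (h a ha h1).trans (h b hb h2).symm⟩
    · obtain ⟨v, hv⟩ := hYne
      by_cases hz : z ∈ Y
      · have h : ∀ w ∈ Y, G.Adj z w → w = y := by
          intro w hw hzw
          rcases hY hw with rfl | rfl | rfl
          · exact absurd hw hx
          · rfl
          · exact absurd rfl hzw.ne
        exact ⟨z, hz, fun a ha b hb h1 h2 => (h a ha h1).trans (h b hb h2).symm⟩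
      · have h : ∀ w ∈ Y, w = y := by
          intro w hw
          rcases hY hw with rfl | rfl | rfl
          · exact absurd hw hx
          · rfl
          · exact absurd hw hz
        exact ⟨v, hv, fun a ha b hb _ _ => (h a ha).trans (h b hb).symm⟩
  refine ⟨_, hX.isStrongForest_two, hxy, fun v hv => ?_⟩
  refine ⟨x, by simp, y, by simp, z, by simp, hxz, hxy, hyz, ?_⟩
  rcases Sym2.mem_iff.mp hv with rfl | rfl <;> simp

end StrongForests

theorem SimpleGraph.hasBagsOfSize_of_treeWidth_eq {V : Type u} {G : SimpleGraph V} {t : ℕ}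
    (ht : 0 < t) (h : treeWidth G = t) : G.HasBagsOfSize (t + 1) := by
  have hne : {w : ℤ | ∃ (ι : Type) (_ : Fintype ι) (T : SimpleGraph ι)
      (D : TreeDecomposition G T), D.width = w}.Nonempty := by
    -- The infimum of the empty set is `0`, which `0 < t` excludes.
    by_contra hne
    rw [Set.not_nonempty_iff_eq_empty] at hne
    rw [treeWidth, hne, Int.csInf_empty] at h
    omega
  obtain ⟨ι, _, T, D, hD⟩ := Int.csInf_mem hne ⟨-1, by
    rintro _ ⟨ι, _, T, D, rfl⟩
    unfold TreeDecomposition.width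
    omega⟩
  have hw : D.width = t := hD.trans h
  unfold TreeDecomposition.width at hw
  refine ⟨ι, T, D, fun x => ?_⟩
  have := Finset.le_sup (f := fun x : ι => {v : V | x ∈ D.B v}.ncard) (Finset.mem_univ x)
  beta_reduce at this
  omega

/-! ### Sharpness for tree-width two. -/

section Bull

/-- The bull: a triangle with pendant edges at two of its vertices. -/
def bull : SimpleGraph (Fin 5) where
  Adj x y := s(x, y) ∈ ({s(0, 1), s(0, 2), s(1, 2), s(0, 3), s(1, 4)} : Finset (Sym2 (Fin 5)))
  symm := ⟨fun x y h => by rwa [Sym2.eq_swap (a := y)]⟩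
  loopless := ⟨by decide⟩

instance : DecidableRel bull.Adj := fun x y => by unfold bull; infer_instance

/-- The path with three vertices. -/
def cherry : SimpleGraph (Fin 3) where
  Adj x y := x ≠ y ∧ (x = 0 ∨ y = 0)
  symm := ⟨fun _ _ h => ⟨h.1.symm, h.2.symm⟩⟩
  loopless := ⟨fun _ h => h.1 rfl⟩

instance : DecidableRel cherry.Adj := fun x y => by unfold cherry; infer_instance

theorem isTree_cherry : cherry.IsTree := by
  rw [isTree_iff_connected_and_card]
  constructor
  · have h : ∀ x, cherry.Reachable 0 x := by
      intro x
      by_cases hx : x = 0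
      · rw [hx]
      · exact Adj.reachable ⟨Ne.symm hx, .inl rfl⟩
    exact ⟨fun x y => (h x).symm.trans (h y)⟩
  · rw [Nat.card_eq_fintype_card, Nat.card_eq_fintype_card]
    decide

/-- A tree decomposition of the bull with bags `{0, 1, 2}`, `{0, 3}` and `{1, 4}`. -/
def bullDecomposition : TreeDecomposition bull cherry where
  isTree := isTree_cherry
  B := ![{0, 1}, {0, 2}, {0}, {1}, {2}]
  connected v := by
    have hs : ∀ x : Fin 3, (cherry.induce {x}).Connected := fun x =>
      have : Nonempty ({x} : Set (Fin 3)) := ⟨⟨x, rfl⟩⟩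
      ⟨Preconnected.of_subsingleton⟩
    fin_cases v
    · exact induce_pair_connected_of_adj (by decide)
    · exact induce_pair_connected_of_adj (by decide)
    · exact hs 0
    · exact hs 1
    · exact hs 2
  meet u v huv := by
    have h : ∀ u v : Fin 5, bull.Adj u v → ∃ x : Fin 3,
        x ∈ (![{0, 1}, {0, 2}, {0}, {1}, {2}] : Fin 5 → Finset (Fin 3)) u ∧
        x ∈ (![{0, 1}, {0, 2}, {0}, {1}, {2}] : Fin 5 → Finset (Fin 3)) v := by decide
    have h' : ∀ (v : Fin 5) (x : Fin 3),
        x ∈ (![{0, 1}, {0, 2}, {0}, {1}, {2}] : Fin 5 → Finset (Fin 3)) v →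
        x ∈ (![{0, 1}, {0, 2}, {0}, {1}, {2}] : Fin 5 → Set (Fin 3)) v := by
      intro v x hx
      fin_cases v <;> simpa using hx
    obtain ⟨x, hu, hv⟩ := h u v huv
    exact ⟨x, h' u x hu, h' v x hv⟩

theorem treeWidth_bull : treeWidth bull = 2 := by
  apply le_antisymm
  · have hle : treeWidth bull ≤ bullDecomposition.width := by
      refine csInf_le ⟨-1, ?_⟩ ⟨Fin 3, inferInstance, cherry, bullDecomposition, rfl⟩
      rintro _ ⟨ι, _, T, D, rfl⟩
      unfold TreeDecomposition.width
      omega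
    have h : (Finset.univ.sup fun x : Fin 3 =>
        {v : Fin 5 | x ∈ bullDecomposition.B v}.ncard) ≤ 3 := by
      refine Finset.sup_le fun x _ => ?_
      have h1 : {v : Fin 5 | x ∈ bullDecomposition.B v} ⊆
          ((![{0, 1, 2}, {0, 3}, {1, 4}] : Fin 3 → Finset (Fin 5)) x : Set (Fin 5)) := by
        intro v hv
        rw [Set.mem_ofPred_eq] at hv
        revert hv
        fin_cases x <;> fin_cases v <;> simp [bullDecomposition]
      refine (Set.ncard_le_ncard h1).trans ?_
      rw [Set.ncard_coe_finset]
      clear h1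
      fin_cases x <;> decide
    unfold TreeDecomposition.width at hle
    omega
  · refine le_csInf ⟨_, Fin 3, inferInstance, cherry, bullDecomposition, rfl⟩ ?_
    rintro _ ⟨ι, _, T, D, rfl⟩
    have h := D.card_le_of_clique (s := {0, 1, 2})
      (fun x => Finset.le_sup (f := fun x : ι => {v : Fin 5 | x ∈ D.B v}.ncard)
        (Finset.mem_univ x)) (by decide)
    have h3 : ({0, 1, 2} : Finset (Fin 5)).card = 3 := rfl
    rw [h3] at h
    unfold TreeDecomposition.width
    omega

/-- Each triangle edge starts an induced path ending in a pendant vertex, and two triangle edges in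
one forest would bring in the whole triangle. -/
theorem three_le_of_hasStrongCover_bull {n : ℕ} (h : HasStrongCover bull 2 n) : 3 ≤ n := by
  obtain ⟨F, hF, hcov⟩ := h
  have hno : ∀ i, ¬ ((0 : Fin 5) ∈ F i ∧ (1 : Fin 5) ∈ F i ∧ (2 : Fin 5) ∈ F i) :=
    fun i h => (hF i).not_triangle h.1 h.2.1 h.2.2 (by decide) (by decide) (by decide)
  obtain ⟨i, -, hi⟩ := hcov _ (isValidEdge_two_of_path (x := 1) (y := 0) (z := 3)
    (by decide) (by decide) (by decide) (by decide))
  obtain ⟨j, -, hj⟩ := hcov _ (isValidEdge_two_of_path (x := 2) (y := 0) (z := 3)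
    (by decide) (by decide) (by decide) (by decide))
  obtain ⟨k, -, hk⟩ := hcov _ (isValidEdge_two_of_path (x := 2) (y := 1) (z := 4)
    (by decide) (by decide) (by decide) (by decide))
  simp only [Sym2.mem_iff, forall_eq_or_imp, forall_eq] at hi hj hk
  have hij : i ≠ j := by rintro rfl; exact hno i ⟨hi.2, hi.1, hj.1⟩
  have hik : i ≠ k := by rintro rfl; exact hno i ⟨hi.2, hi.1, hk.1⟩
  have hjk : j ≠ k := by rintro rfl; exact hno j ⟨hj.2, hk.2, hk.1⟩
  have := Finset.card_le_univ ({i, j, k} : Finset (Fin n))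
  rwa [Finset.card_eq_three.mpr ⟨i, j, k, hij, hik, hjk, rfl⟩, Fintype.card_fin] at this

end Bull

theorem theorem4 :
    (∀ (V : Type u) [Finite V] (G : SimpleGraph V) (t : ℕ), 2 ≤ t → treeWidth G = (t : ℤ) →
      strongInducedArboricity 1 G ≤ Nat.choose (t + 1) 2 ∧
      strongInducedArboricity 2 G ≤ 3 * Nat.choose (t + 1) 3) ∧
    (∃ (n : ℕ) (G : SimpleGraph (Fin n)), treeWidth G = 2 ∧
      strongInducedArboricity 2 G = 3 * Nat.choose (2 + 1) 3) := by
  refine ⟨fun V _ G t ht h => ?_, 5, bull, treeWidth_bull, le_antisymm ?_ ?_⟩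
  · have hG := hasBagsOfSize_of_treeWidth_eq (by omega) h
    exact ⟨strongInducedArboricity_one_le (by omega) hG,
      strongInducedArboricity_two_le (by omega) hG⟩
  · exact strongInducedArboricity_two_le le_rfl
      (hasBagsOfSize_of_treeWidth_eq (t := 2) (by omega) treeWidth_bull)
  · exact three_le_of_hasStrongCover_bull (hasStrongCover_strongInducedArboricity bull 2)
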